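/- Let $\alpha,\beta\in\mathbb{N}$, let $\vec p=(p_1,\dots,p_\alpha)$ and $\vec q=(q_1,\dots,q_\beta)$ be stochastic vectors (non-negative entries summing to $1$), and let $F=[f_{rs}]$ be an $\alpha\times\beta$ matrix with entries $0<f_{rs}\le 1$. Let $\Omega_W=\{1,\dots,\alpha\}^{\mathbb{N}}$ carry the product measure $\mu_W$ of the probability measure $\{r\}\mapsto p_r$, let $\Omega_M=\{1,\dots,\beta\}^{\mathbb{N}}$ carry the product measure $\mu_M$ of $\{s\}\mapsto q_s$, and let $\Omega=\Omega_W\times\Omega_M$ carry $\mu_W\times\mu_M$. For an environment $\omega=((w_i)_{i\ge1},(m_j)_{j\ge1})\in\Omega$ and $n\in\mathbb{N}$, let $G_{n,\omega}$ be the random bipartite graph with $n$ vertices on either side in which the edges are independent and the edge between the $i$-th left and the $j$-th right vertex is present with probability $f_{w_i m_j}$; let $\mathbb{E}_{n,\omega}$ be the expectation with respect to its law, and let $\mathrm{pm}(G)$ be the number of perfect matchings of a graph $G$. Define the scaling mean $$\mathrm{sm}_{\vec p,\vec q}(F)=\inf_{x\in(0,\infty)^\alpha,\;y\in(0,\infty)^\beta}\Big(\prod_{r=1}^{\alpha}x_r^{-p_r}\Big)\Big(\prod_{s=1}^{\beta}y_s^{-q_s}\Big)\Big(\sum_{r=1}^{\alpha}\sum_{s=1}^{\beta}x_r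 f_{rs}y_s\,p_rq_s\Big).$$ Then for every $\omega\in\Omega$ and every $n$, $\mathbb{E}_{n,\omega}(\mathrm{pm}(G_{n,\omega}))$ is the permanent of the $n\times n$ matrix $A_n(\omega)$ with entries $f_{w_i m_j}$, and for $\mu_W\times\mu_M$-almost every $\omega\in\Omega$, $$\lim_{n\to\infty}\left(\frac{\mathbb{E}_{n,\omega}(\mathrm{pm}(G_{n,\omega}))}{n!}\right)^{1/n}=\mathrm{sm}_{\vec p,\vec q}(F).$$ -/

import Mathlib

open MeasureTheory ProbabilityTheory Filter
open scoped Topology unitInterval Nat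

namespace RandomEnvironment

/-- The probability measure on `{1, …, k}` that gives mass `p i` to `{i}`, for a stochastic
vector `p`. -/
noncomputable def letterLaw {k : ℕ} (p : stdSimplex ℝ (Fin k)) : Measure (Fin k) :=
  ∑ i, ENNReal.ofReal (p i) • Measure.dirac i

instance {k : ℕ} (p : stdSimplex ℝ (Fin k)) : IsProbabilityMeasure (letterLaw p) where
  measure_univ := by
    have h : ∀ i ∈ Finset.univ, 0 ≤ (p : Fin k → ℝ) i := fun i _ => p.2.1 i
    have h1 : ∑ i, (p : Fin k → ℝ) i = 1 := p.2.2
    simp only [letterLaw, Measure.coe_finsetSum, Finset.sum_apply, Measure.smul_apply,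
      measure_univ, smul_eq_mul, mul_one]
    exact (ENNReal.ofReal_sum_of_nonneg h).symm.trans (by rw [h1, ENNReal.ofReal_one])

/-- The Bernoulli measure on the space of sequences of letters: the letters are independent
with law `letterLaw p`. -/
noncomputable def bernoulliShift {k : ℕ} (p : stdSimplex ℝ (Fin k)) : Measure (ℕ → Fin k) :=
  Measure.infinitePi fun _ : ℕ => letterLaw p

instance {k : ℕ} (p : stdSimplex ℝ (Fin k)) : IsProbabilityMeasure (bernoulliShift p) := by
  unfold bernoulliShift; infer_instance

/-- An environment: a pair of sequences of letters `(w₁, w₂, …)` and `(m₁, m₂, …)`. -/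
abbrev Environment (α β : ℕ) : Type := (ℕ → Fin α) × (ℕ → Fin β)

/-- The product measure on the space of environments. -/
noncomputable def environmentMeasure {α β : ℕ} (p : stdSimplex ℝ (Fin α))
    (q : stdSimplex ℝ (Fin β)) : Measure (Environment α β) :=
  (bernoulliShift p).prod (bernoulliShift q)

/-- The probability of the edge between the `i`-th left and the `j`-th right vertex. -/
def edgeProb {α β : ℕ} (F : Matrix (Fin α) (Fin β) I) (ω : Environment α β) (i j : ℕ) : I :=
  F (ω.1 i) (ω.2 j)

/-- The matrix of the edge probabilities between the first `n` vertices on either side. -/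
def edgeProbMatrix {α β : ℕ} (F : Matrix (Fin α) (Fin β) I) (n : ℕ) (ω : Environment α β) :
    Matrix (Fin n) (Fin n) ℝ :=
  Matrix.of fun i j => (edgeProb F ω i j : ℝ)

/-- The bipartite graph with `n` vertices on either side in which the left vertex `i` and the
right vertex `j` are adjacent exactly when `x (i, j)` is `true`. -/
def bipartiteGraph {n : ℕ} (x : Fin n × Fin n → Bool) : SimpleGraph (Fin n ⊕ Fin n) :=
  SimpleGraph.fromRel fun u v => ∃ i j, u = Sum.inl i ∧ v = Sum.inr j ∧ x (i, j) = true

/-- The joint law of the independent edge indicators, the one at `(i, j)` being `true` with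
probability `edgeProb F ω i j`. -/
noncomputable def edgeLaw {α β : ℕ} (F : Matrix (Fin α) (Fin β) I) (n : ℕ)
    (ω : Environment α β) : Measure (Fin n × Fin n → Bool) :=
  Measure.pi fun e => bernoulliMeasure true false (edgeProb F ω e.1 e.2)

/-- The law of the inhomogeneous random bipartite graph in the environment `ω`. -/
noncomputable def graphLaw {α β : ℕ} (F : Matrix (Fin α) (Fin β) I) (n : ℕ)
    (ω : Environment α β) : Measure (SimpleGraph (Fin n ⊕ Fin n)) :=
  (edgeLaw F n ω).map bipartiteGraph

instance {α β : ℕ} (F : Matrix (Fin α) (Fin β) I) (n : ℕ) (ω : Environment α β) :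
    IsProbabilityMeasure (graphLaw F n ω) := by
  have : IsProbabilityMeasure (edgeLaw F n ω) := by unfold edgeLaw; infer_instance
  exact Measure.isProbabilityMeasure_map Measurable.of_discrete.aemeasurable

/-- The number of perfect matchings of a graph. -/
noncomputable def perfectMatchings {V : Type*} (G : SimpleGraph V) : ℕ :=
  {M : G.Subgraph | M.IsPerfectMatching}.ncard

/-- The expected number of perfect matchings of the random graph in the environment `ω`. -/
noncomputable def expectedPerfectMatchings {α β : ℕ} (F : Matrix (Fin α) (Fin β) I) (n : ℕ)
    (ω : Environment α β) : ℝ :=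
  ∫ G, (perfectMatchings G : ℝ) ∂(graphLaw F n ω)

/-- The scaling mean of a matrix with respect to two weight vectors; the infimum is over all
vectors with strictly positive entries. -/
noncomputable def scalingMean {α β : ℕ} (p : Fin α → ℝ) (q : Fin β → ℝ)
    (F : Matrix (Fin α) (Fin β) ℝ) : ℝ :=
  ⨅ z : {x : Fin α → ℝ // ∀ r, 0 < x r} × {y : Fin β → ℝ // ∀ s, 0 < y s},
    (∏ r, z.1.1 r ^ (-p r)) * (∏ s, z.2.1 s ^ (-q s)) *
      ∑ r, ∑ s, z.1.1 r * F r s * z.2.1 s * p r * q s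

end RandomEnvironment

/-!
Write `a` and `b` for the letter counts of the first `n` letters of the two sequences and `f` for the
matrix of edge probabilities. A perfect matching of the random graph is a permutation all of whose
edges are present, so by independence the expected number of perfect matchings is a permanent
(`expectedPerfectMatchings_eq_permanent`).

Symmetrizing over rows and columns, `n!` times that permanent is `∏ a! * ∏ b!` times the coefficient
of `u ^ a * v ^ b` in `(∑ u r * f r s * v s) ^ n` (`factorial_mul_permanent`). This gives two
bounds. A coefficient is at most the value of the polynomial divided by the monomial, for any
`u, v ≥ 0` (`permanent_mul_le`). With `u = x * p` and `v = y * q`, Stirling's formula and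
`a / n → p`, `b / n → q`, the upper bound on the growth rate is the functional defining the scaling
mean at `(x, y)` (`exists_upper_tendsto`). Conversely, a coefficient is at least any one of its
multinomial terms, indexed by the tables `N` with margins `a` and `b` (`le_permanent_of_table`).
Because `f` is positive, there is a scaling `t r s = x r * f r s * y s * p r * q s` with marginals
`p` and `q` (`exists_scaling`; it comes from a maximizer of `scalingQuotient` on the simplex), and
tables with `N / n → t` exist (`exists_tables_tendsto`). Their terms grow at the rate given by the
functional at this `(x, y)` (`exists_lower_tendsto`). Comparing the lower bound with all the upper
bounds shows that this `(x, y)` attains the infimum and that the growth rate is the scaling mean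
(`tendsto_permanent_rpow`). The strong law of large numbers supplies the letter frequencies almost
surely; almost surely, moreover, no letter of weight zero occurs.
-/

namespace RandomEnvironment

open Finset in
/-- The number of times the letter `k` occurs in the finite word `g`. -/
def letterCount {ι κ : Type*} [Fintype ι] [DecidableEq κ] (g : ι → κ) (k : κ) : ℕ :=
  #{i | g i = k}

/-! ### Rearrangements of finite words -/

section Counting

variable {ι κ : Type*} [Fintype ι] [DecidableEq ι] [Fintype κ] [DecidableEq κ]

omit [DecidableEq ι] in
lemma sum_letterCount (g : ι → κ) : ∑ k, letterCount g k = Fintype.card ι :=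
  (Finset.card_eq_sum_card_fiberwise (fun _ _ => Finset.mem_coe.2 (Finset.mem_univ _))).symm

omit [DecidableEq ι] [Fintype κ] in
lemma letterCount_comp_perm (g : ι → κ) (π : Equiv.Perm ι) :
    letterCount (g ∘ π) = letterCount g := by
  funext k
  unfold letterCount
  exact Finset.card_equiv π (by simp)

omit [DecidableEq ι] [Fintype κ] in
lemma exists_perm_comp_eq {g g' : ι → κ} (h : letterCount g' = letterCount g) :
    ∃ π : Equiv.Perm ι, g ∘ π = g' := by
  have e : ∀ k, {i // g' i = k} ≃ {i // g i = k} := fun k =>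
    Fintype.equivOfCardEq (by
      simpa [Fintype.card_subtype, letterCount] using congrFun h k)
  refine ⟨(Equiv.sigmaFiberEquiv g').symm.trans
    ((Equiv.sigmaCongrRight e).trans (Equiv.sigmaFiberEquiv g)), ?_⟩
  funext i
  exact (e (g' i) ⟨i, rfl⟩).2

open Finset in
/-- The permutations that carry a word to a given rearrangement of it form a coset of the
stabilizer of the word. -/
lemma card_perm_comp_eq {g g' : ι → κ} (h : letterCount g' = letterCount g) :
    #{π : Equiv.Perm ι | g ∘ π = g'} = ∏ k, (letterCount g k)! := by
  obtain ⟨π₀, rfl⟩ := exists_perm_comp_eq h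
  have h1 := DomMulAct.stabilizer_card g
  simp only [Fintype.card_subtype] at h1
  unfold letterCount
  rw [← h1]
  refine Finset.card_equiv (Equiv.mulRight π₀⁻¹) fun π => ?_
  simp only [Finset.mem_filter, Finset.mem_univ, true_and, Equiv.coe_mulRight, Equiv.Perm.coe_mul]
  rw [← Function.comp_assoc]
  constructor
  · intro h
    rw [h]
    funext i
    simp
  · intro h
    funext i
    simpa using congrFun h (π₀ i)

/-- Averaging over all permutations of a word is averaging over its rearrangements. -/
lemma sum_perm_comp (g : ι → κ) (Φ : (ι → κ) → ℝ) :
    ∑ π : Equiv.Perm ι, Φ (g ∘ π)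
      = (∏ k, ((letterCount g k)! : ℝ)) * ∑ g' : ι → κ with letterCount g' = letterCount g, Φ g' := by
  rw [← Finset.sum_fiberwise_of_maps_to (s := Finset.univ)
    (t := {g' | letterCount g' = letterCount g}) (g := fun π : Equiv.Perm ι => g ∘ π)
    (fun π _ => by simp [letterCount_comp_perm]), Finset.mul_sum]
  refine Finset.sum_congr rfl fun g' hg' => ?_
  have h := card_perm_comp_eq (Finset.mem_filter.1 hg').2
  rw [Finset.sum_congr rfl (fun π hπ => by rw [(Finset.mem_filter.1 hπ).2]), Finset.sum_const, h,
    nsmul_eq_mul]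
  push_cast
  rfl

omit [DecidableEq ι] in
/-- Words with prescribed letter counts exist. -/
lemma exists_letterCount_eq (N : κ → ℕ) (hN : ∑ k, N k = Fintype.card ι) :
    ∃ g : ι → κ, letterCount g = N := by
  have e : ι ≃ Σ k, Fin (N k) := Fintype.equivOfCardEq (by simp [hN])
  refine ⟨fun i => (e i).1, ?_⟩
  funext k
  have : letterCount (fun i => (e i).1) k = Fintype.card {x : Σ k, Fin (N k) // x.1 = k} := by
    rw [Fintype.card_subtype]
    exact Finset.card_equiv e (by simp)
  rw [this, Fintype.card_congr (Equiv.sigmaSubtype k)]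
  simp

end Counting

/-! ### Contingency tables -/

section Tables

variable {ι A B : Type*} [Fintype ι] [Fintype A] [DecidableEq A] [Fintype B] [DecidableEq B]

omit [Fintype A] in
lemma sum_letterCount_snd (c : ι → A × B) (r : A) :
    ∑ s, letterCount c (r, s) = letterCount (fun i => (c i).1) r := by
  unfold letterCount
  rw [Finset.card_eq_sum_card_fiberwise (t := Finset.univ) (f := fun i => (c i).2)
    (fun _ _ => Finset.mem_coe.2 (Finset.mem_univ _))]
  refine Finset.sum_congr rfl fun s _ => ?_
  rw [Finset.filter_filter]
  simp [Prod.ext_iff]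

omit [Fintype B] in
lemma sum_letterCount_fst (c : ι → A × B) (s : B) :
    ∑ r, letterCount c (r, s) = letterCount (fun i => (c i).2) s := by
  unfold letterCount
  rw [Finset.card_eq_sum_card_fiberwise (t := Finset.univ) (f := fun i => (c i).1)
    (fun _ _ => Finset.mem_coe.2 (Finset.mem_univ _))]
  refine Finset.sum_congr rfl fun r _ => ?_
  rw [Finset.filter_filter]
  simp [Prod.ext_iff, and_comm]

/-- Two families of margins with the same total are the margins of some contingency table. -/
lemma exists_table (a : A → ℕ) (b : B → ℕ) (hab : ∑ r, a r = ∑ s, b s) :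
    ∃ R : A → B → ℕ, (∀ r, ∑ s, R r s = a r) ∧ ∀ s, ∑ r, R r s = b s := by
  obtain ⟨w, hw⟩ := exists_letterCount_eq (ι := Fin (∑ r, a r)) a (by simp)
  obtain ⟨m, hm⟩ := exists_letterCount_eq (ι := Fin (∑ r, a r)) b (by simp [hab])
  refine ⟨fun r s => letterCount (fun i => (w i, m i)) (r, s), fun r => ?_, fun s => ?_⟩
  · exact (sum_letterCount_snd _ r).trans (congrFun hw r)
  · exact (sum_letterCount_fst _ s).trans (congrFun hm s)

end Tables

/-! ### Permanents of matrices indexed by letters -/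

section Permanent

variable {ι A B : Type*} [Fintype ι] [DecidableEq ι] [Fintype A] [DecidableEq A] [Fintype B]
  [DecidableEq B]

/-- The permanent of a matrix whose entries depend only on the letters of the row and of the
column, as a sum over all pairs of rearrangements of the two words. -/
lemma factorial_mul_permanent (f : A → B → ℝ) (w : ι → A) (m : ι → B) :
    ((Fintype.card ι)! : ℝ) * (Matrix.of fun i j => f (w i) (m j)).permanent
      = (∏ r, ((letterCount w r)! : ℝ)) * (∏ s, ((letterCount m s)! : ℝ)) *
        ∑ w' : ι → A with letterCount w' = letterCount w,
          ∑ m' : ι → B with letterCount m' = letterCount m,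
          ∏ i, f (w' i) (m' i) := by
  have key : ∑ ρ : Equiv.Perm ι, ∑ π : Equiv.Perm ι, ∏ i, f ((w ∘ π) i) ((m ∘ ρ) i)
      = ((Fintype.card ι)! : ℝ) * (Matrix.of fun i j => f (w i) (m j)).permanent := by
    rw [← Fintype.card_perm, ← nsmul_eq_mul, ← Finset.card_univ, ← Finset.sum_const]
    refine Finset.sum_congr rfl fun ρ _ => ?_
    unfold Matrix.permanent
    refine Fintype.sum_equiv (Equiv.mulRight ρ⁻¹) _ _ fun π => ?_
    refine Fintype.prod_equiv ρ _ _ fun i => ?_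
    simp
  rw [← key, sum_perm_comp m (fun m' => ∑ π : Equiv.Perm ι, ∏ i, f ((w ∘ π) i) (m' i)),
    mul_comm (∏ r, ((letterCount w r)! : ℝ)), mul_assoc]
  congr 1
  rw [Finset.sum_comm (f := fun (w' : ι → A) (m' : ι → B) => ∏ i, f (w' i) (m' i)), Finset.mul_sum]
  exact Finset.sum_congr rfl fun m' _ => sum_perm_comp w (fun w' => ∏ i, f (w' i) (m' i))

omit [DecidableEq ι] in
lemma prod_comp_eq_prod_pow (g : ι → A) (u : A → ℝ) :
    ∏ i, u (g i) = ∏ r, u r ^ letterCount g r := by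
  rw [← Finset.prod_fiberwise_of_maps_to (t := Finset.univ) (g := g) (by simp)]
  refine Finset.prod_congr rfl fun r _ => ?_
  rw [Finset.prod_congr rfl (fun i hi => by rw [(Finset.mem_filter.1 hi).2]), Finset.prod_const]
  rfl

/-- Generating-function bound: up to the factorials, the permanent is a coefficient of the
`n`-th power of the bilinear form `∑ u r * f r s * v s`. -/
lemma permanent_mul_le (f : A → B → ℝ) (hf : ∀ r s, 0 ≤ f r s) (w : ι → A) (m : ι → B)
    {u : A → ℝ} {v : B → ℝ} (hu : ∀ r, 0 ≤ u r) (hv : ∀ s, 0 ≤ v s) :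
    ((Fintype.card ι)! : ℝ) * (Matrix.of fun i j => f (w i) (m j)).permanent *
        ((∏ r, u r ^ letterCount w r) * ∏ s, v s ^ letterCount m s)
      ≤ (∏ r, ((letterCount w r)! : ℝ)) * (∏ s, ((letterCount m s)! : ℝ)) *
        (∑ r, ∑ s, u r * f r s * v s) ^ Fintype.card ι := by
  rw [factorial_mul_permanent, mul_assoc]
  refine mul_le_mul_of_nonneg_left ?_ (by positivity)
  have nn : ∀ r s, 0 ≤ u r * f r s * v s := fun r s => by
    have := hu r; have := hv s; have := hf r s; positivity
  have h2 : (∑ r, ∑ s, u r * f r s * v s) ^ Fintype.card ι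
      = ∑ w' : ι → A, ∑ m' : ι → B, ∏ i, u (w' i) * f (w' i) (m' i) * v (m' i) := by
    rw [← Fintype.sum_prod_type' (f := fun r s => u r * f r s * v s), ← Finset.card_univ,
      ← Finset.prod_const, Fintype.prod_sum,
      ← Fintype.sum_prod_type' (f := fun (w' : ι → A) (m' : ι → B) =>
        ∏ i, u (w' i) * f (w' i) (m' i) * v (m' i))]
    exact Fintype.sum_equiv (Equiv.arrowProdEquivProdArrow ι (fun _ => A) (fun _ => B)) _ _
      fun c => rfl
  rw [h2, Finset.sum_mul]
  refine (Finset.sum_le_sum fun w' hw' => ?_).trans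
    (Finset.sum_le_sum_of_subset_of_nonneg (Finset.subset_univ _) fun w' _ _ =>
      Finset.sum_nonneg fun m' _ => Finset.prod_nonneg fun i _ => nn _ _)
  rw [Finset.sum_mul]
  refine (Finset.sum_le_sum fun m' hm' => ?_).trans
    (Finset.sum_le_sum_of_subset_of_nonneg (Finset.subset_univ _) fun m' _ _ =>
      Finset.prod_nonneg fun i _ => nn _ _)
  rw [← (Finset.mem_filter.1 hw').2, ← (Finset.mem_filter.1 hm').2, ← prod_comp_eq_prod_pow,
    ← prod_comp_eq_prod_pow, Finset.prod_mul_distrib, Finset.prod_mul_distrib]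
  exact le_of_eq (by ring)

/-- Each contingency table with the right margins bounds the permanent from below by the
contribution of the permutations with that table. -/
lemma le_permanent_of_table (f : A → B → ℝ) (hf : ∀ r s, 0 ≤ f r s) (w : ι → A) (m : ι → B)
    (N : A → B → ℕ) (hw : ∀ r, ∑ s, N r s = letterCount w r)
    (hm : ∀ s, ∑ r, N r s = letterCount m s) :
    (∏ r, ((letterCount w r)! : ℝ)) * (∏ s, ((letterCount m s)! : ℝ)) *
        ∏ r, ∏ s, f r s ^ N r s
      ≤ (∏ r, ∏ s, ((N r s)! : ℝ)) * (Matrix.of fun i j => f (w i) (m j)).permanent := by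
  obtain ⟨c, hc⟩ := exists_letterCount_eq (ι := ι) (fun x : A × B => N x.1 x.2) (by
    rw [Fintype.sum_prod_type, ← sum_letterCount w]
    exact Finset.sum_congr rfl fun r _ => hw r)
  -- The product is constant on the rearrangements of the word `c` of pairs with table `N`; these
  -- rearrangements project to pairs of rearrangements of `w` and `m`.
  have hcount := sum_perm_comp c (fun c' => ∏ i, f (c' i).1 (c' i).2)
  have h1 : ∀ π : Equiv.Perm ι, ∏ i, f ((c ∘ π) i).1 ((c ∘ π) i).2
      = ∏ r, ∏ s, f r s ^ N r s := fun π => by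
    rw [prod_comp_eq_prod_pow (c ∘ π) (fun x : A × B => f x.1 x.2), letterCount_comp_perm, hc,
      Fintype.prod_prod_type]
  simp only [h1, Finset.sum_const, nsmul_eq_mul, Finset.card_univ, Fintype.card_perm, hc,
    Fintype.prod_prod_type] at hcount
  have h2 : ∑ c' : ι → A × B with letterCount c' = letterCount c, ∏ i, f (c' i).1 (c' i).2
      ≤ ∑ w' : ι → A with letterCount w' = letterCount w,
          ∑ m' : ι → B with letterCount m' = letterCount m,
          ∏ i, f (w' i) (m' i) := by
    rw [← Finset.sum_product']
    refine le_of_eq_of_le (Finset.sum_map _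
      (Equiv.arrowProdEquivProdArrow ι (fun _ => A) (fun _ => B)).toEmbedding
      (fun x : (ι → A) × (ι → B) => ∏ i, f (x.1 i) (x.2 i))).symm
      (Finset.sum_le_sum_of_subset_of_nonneg ?_ fun x _ _ => Finset.prod_nonneg fun i _ => hf _ _)
    intro x hx
    obtain ⟨c', hc', rfl⟩ := Finset.mem_map.1 hx
    have hc'' := (Finset.mem_filter.1 hc').2
    simp only [Finset.mem_product, Finset.mem_filter, Finset.mem_univ, true_and]
    constructor
    · funext r
      rw [← hw r]
      refine (sum_letterCount_snd c' r).symm.trans ?_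
      rw [hc'', hc]
    · funext s
      rw [← hm s]
      refine (sum_letterCount_fst c' s).symm.trans ?_
      rw [hc'', hc]
  have hfac : (0 : ℝ) < ((Fintype.card ι)! : ℝ) := by positivity
  refine le_of_mul_le_mul_left ?_ hfac
  rw [mul_left_comm ((Fintype.card ι)! : ℝ) (∏ r, ∏ s, ((N r s)! : ℝ)), factorial_mul_permanent,
    mul_left_comm, hcount, mul_left_comm (∏ r, ∏ s, ((N r s)! : ℝ))]
  rw [hc] at h2
  gcongr

end Permanent

/-! ### Factorials to first exponential order -/

section Stirling

lemma le_log_factorial (k : ℕ) : k * Real.log k - k ≤ Real.log (k ! : ℝ) := by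
  rcases Nat.eq_zero_or_pos k with rfl | hk
  · simp
  · have h := Stirling.le_log_factorial_stirling hk.ne'
    have h1 : 0 ≤ Real.log k := Real.log_natCast_nonneg k
    have h2 : 0 ≤ Real.log (2 * Real.pi) := Real.log_nonneg (by linarith [Real.two_le_pi])
    linarith

lemma log_factorial_le (k : ℕ) : Real.log (k ! : ℝ) ≤ k * Real.log k - k + √k := by
  rcases k with _ | m
  · simp
  · have h := Stirling.log_stirlingSeq'_antitone (Nat.zero_le m)
    simp only [Function.comp_apply, Nat.succ_eq_add_one, zero_add] at h
    rw [Stirling.log_stirlingSeq_formula, Stirling.log_stirlingSeq_formula] at h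
    set k : ℕ := m + 1 with hk
    have hk0 : (0 : ℝ) < k := by rw [hk]; positivity
    have h1 : Real.log (√k) ≤ √k - 1 := Real.log_le_sub_one_of_pos (Real.sqrt_pos.2 hk0)
    rw [Real.log_sqrt hk0.le] at h1
    rw [Real.log_mul two_ne_zero hk0.ne', Real.log_div hk0.ne' (Real.exp_pos 1).ne',
      Real.log_exp] at h
    simp at h
    linarith

/-- Stirling's formula to first exponential order, for factorials of a sequence that grows
linearly. -/
lemma tendsto_log_factorial {k : ℕ → ℕ} {t : ℝ}
    (h : Tendsto (fun n : ℕ => (k n : ℝ) / n) atTop (𝓝 t)) :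
    Tendsto (fun n : ℕ => (Real.log ((k n)! : ℝ) - k n * Real.log n) / n) atTop
      (𝓝 (t * Real.log t - t)) := by
  have hmain : Tendsto (fun n : ℕ => (k n : ℝ) / n * Real.log ((k n : ℝ) / n) - (k n : ℝ) / n)
      atTop (𝓝 (t * Real.log t - t)) :=
    ((Real.continuous_mul_log.tendsto t).comp h).sub h
  have herr : Tendsto (fun n : ℕ => √((k n : ℝ) / n) * √(1 / (n : ℝ))) atTop (𝓝 0) := by
    have h1 : Tendsto (fun n : ℕ => √(1 / (n : ℝ))) atTop (𝓝 (√0)) :=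
      (Real.continuous_sqrt.tendsto 0).comp tendsto_one_div_atTop_nhds_zero_nat
    simpa using ((Real.continuous_sqrt.tendsto t).comp h).mul h1
  have hid : ∀ n : ℕ, 0 < n → (k n : ℝ) / n * Real.log ((k n : ℝ) / n) - (k n : ℝ) / n
      = (k n * Real.log (k n) - k n - k n * Real.log n) / n := fun n hn => by
    have hn' : (n : ℝ) ≠ 0 := by positivity
    rcases Nat.eq_zero_or_pos (k n) with h0 | h0
    · simp [h0]
    · rw [Real.log_div (by positivity) hn']
      ring
  refine tendsto_of_tendsto_of_tendsto_of_le_of_le' hmain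
    (by simpa only [add_zero] using hmain.add herr) ?_ ?_
  · filter_upwards [eventually_gt_atTop 0] with n hn
    rw [hid n hn]
    have := le_log_factorial (k n)
    gcongr
  · filter_upwards [eventually_gt_atTop 0] with n hn
    have hn' : (0 : ℝ) < n := by positivity
    have hs : √((k n : ℝ) / n) * √(1 / (n : ℝ)) = √(k n) / n := by
      rw [← Real.sqrt_mul (by positivity), div_mul_div_comm, mul_one,
        Real.sqrt_div (by positivity), Real.sqrt_mul_self hn'.le]
    rw [hid n hn, hs, ← add_div]
    have := log_factorial_le (k n)
    gcongr
    linarith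

end Stirling

/-! ### Scaling a positive matrix to prescribed marginals -/

section Scaling

variable {A B : Type*} [Fintype A] [Fintype B]

/-- The quotient whose maximizers `u` over the standard simplex give the scaling of `f`: the
weighted geometric mean of `u` over that of its image under `f`. -/
noncomputable def scalingQuotient (p : A → ℝ) (q : B → ℝ) (f : A → B → ℝ) (u : A → ℝ) : ℝ :=
  (∏ r, u r ^ p r) / ∏ s, (∑ r, u r * f r s) ^ q s

lemma scalingQuotient_smul {p : A → ℝ} {q : B → ℝ} {f : A → B → ℝ} (hp1 : ∑ r, p r = 1)
    (hq1 : ∑ s, q s = 1) (hf : ∀ r s, 0 < f r s) {c : ℝ} (hc : 0 < c) {u : A → ℝ}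
    (hu : ∀ r, 0 ≤ u r) :
    scalingQuotient p q f (c • u) = scalingQuotient p q f u := by
  have hD : ∀ s, 0 ≤ ∑ r, u r * f r s := fun s =>
    Finset.sum_nonneg fun r _ => mul_nonneg (hu r) (hf r s).le
  unfold scalingQuotient
  simp only [Pi.smul_apply, smul_eq_mul, mul_assoc, ← Finset.mul_sum]
  simp only [Real.mul_rpow hc.le (hu _), Real.mul_rpow hc.le (hD _), Finset.prod_mul_distrib,
    ← Real.rpow_sum_of_pos hc, hp1, hq1, Real.rpow_one]
  rw [mul_div_mul_left _ _ hc.ne']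

lemma sum_mul_pos_of_mem_stdSimplex {f : A → ℝ} (hf : ∀ r, 0 < f r) {u : A → ℝ}
    (hu : u ∈ stdSimplex ℝ A) : 0 < ∑ r, u r * f r := by
  have h0 : ∀ r ∈ Finset.univ, 0 ≤ u r * f r := fun r _ => mul_nonneg (hu.1 r) (hf r).le
  refine (Finset.sum_nonneg h0).lt_of_ne' fun h => ?_
  have h1 : ∀ r, u r = 0 := fun r => by
    simpa [(hf r).ne'] using (Finset.sum_eq_zero_iff_of_nonneg h0).1 h r (Finset.mem_univ r)
  simpa [h1] using hu.2

/-- The stationarity condition at a maximizer of the scaling quotient, for a letter of positive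
weight. -/
lemma stationary_of_isMaxOn [DecidableEq A] {p : A → ℝ} {q : B → ℝ} {f : A → B → ℝ}
    (hp : p ∈ stdSimplex ℝ A)
    (hq : q ∈ stdSimplex ℝ B) (hf : ∀ r s, 0 < f r s) {u : A → ℝ} (hu : u ∈ stdSimplex ℝ A)
    (hmax : IsMaxOn (scalingQuotient p q f) (stdSimplex ℝ A) u) {r : A} (hr : p r ≠ 0) :
    u r * ∑ s, q s * f r s / (∑ r', u r' * f r' s) = p r := by
  have hD : ∀ s, 0 < ∑ r, u r * f r s := fun s => sum_mul_pos_of_mem_stdSimplex (hf · s) hu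
  have hpos : 0 < scalingQuotient p q f u := by
    refine lt_of_lt_of_le ?_ (hmax hp)
    refine div_pos (Finset.prod_pos fun r _ => ?_) (Finset.prod_pos fun s _ =>
      Real.rpow_pos_of_pos (sum_mul_pos_of_mem_stdSimplex (hf · s) hp) _)
    rcases (hp.1 r).eq_or_lt with h | h
    · simp [← h]
    · exact Real.rpow_pos_of_pos h _
  have hprod : ∏ r, u r ^ p r ≠ 0 := fun h => by simp [scalingQuotient, h] at hpos
  have hur' : ∀ r', 0 < u r' ^ p r' := fun r' =>
    (Real.rpow_nonneg (hu.1 r') _).lt_of_ne' (Finset.prod_ne_zero_iff.1 hprod r'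
      (Finset.mem_univ _))
  have hur : 0 < u r := (hu.1 r).lt_of_ne' fun h => by
    simpa [h, Real.zero_rpow hr] using hur' r
  -- By homogeneity the maximizer also dominates its perturbations in the `r`-th coordinate.
  have hloc : IsLocalMax (fun τ : ℝ => p r * Real.log (u r + τ)
      - ∑ s, q s * Real.log ((∑ r', u r' * f r' s) + τ * f r s)) 0 := by
    have ev : ∀ᶠ τ : ℝ in 𝓝 0, 0 < u r + τ ∧ 0 < 1 + τ ∧
        ∀ s, 0 < (∑ r', u r' * f r' s) + τ * f r s := by
      refine Filter.Eventually.and ?_ (Filter.Eventually.and ?_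
        (Filter.eventually_all.2 fun s => ?_))
      · exact (by fun_prop : Continuous fun τ : ℝ => u r + τ).tendsto 0 |>.eventually
          (lt_mem_nhds (by simpa using hur))
      · exact (by fun_prop : Continuous fun τ : ℝ => 1 + τ).tendsto 0 |>.eventually
          (lt_mem_nhds (by simp))
      · exact (by fun_prop : Continuous fun τ : ℝ => (∑ r', u r' * f r' s) + τ * f r s).tendsto 0
          |>.eventually (lt_mem_nhds (by simpa using hD s))
    filter_upwards [ev] with τ ⟨h1, h2, h3⟩
    set v : A → ℝ := Function.update u r (u r + τ) with hv
    have hv0 : ∀ r', 0 ≤ v r' := fun r' => by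
      by_cases h : r' = r
      · subst h; simpa [hv] using h1.le
      · simpa [hv, h] using hu.1 r'
    have hvsum : ∀ g : A → ℝ, ∑ r', v r' * g r' = (∑ r', u r' * g r') + τ * g r := fun g => by
      have : ∀ r', v r' * g r' = u r' * g r' + if r' = r then τ * g r else 0 := fun r' => by
        by_cases h : r' = r
        · subst h; simp [hv]; ring
        · simp [hv, h]
      simp [this, Finset.sum_add_distrib]
    have hmem : (1 + τ)⁻¹ • v ∈ stdSimplex ℝ A := by
      refine ⟨fun r' => mul_nonneg (by positivity) (hv0 r'), ?_⟩
      have := hvsum (fun _ => 1)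
      simp only [mul_one, hu.2] at this
      simp only [Pi.smul_apply, smul_eq_mul, ← Finset.mul_sum, this]
      exact inv_mul_cancel₀ h2.ne'
    have hle : scalingQuotient p q f v ≤ scalingQuotient p q f u := by
      rw [← scalingQuotient_smul hp.2 hq.2 hf (inv_pos.2 h2) hv0]
      exact hmax hmem
    have hC : 0 < ∏ r' ∈ Finset.univ.erase r, u r' ^ p r' := Finset.prod_pos fun r' _ => hur' r'
    unfold scalingQuotient at hle
    rw [← Finset.mul_prod_erase _ _ (Finset.mem_univ r),
      ← Finset.mul_prod_erase _ (fun r => u r ^ p r) (Finset.mem_univ r)] at hle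
    have hcongr : ∏ r' ∈ Finset.univ.erase r, v r' ^ p r'
        = ∏ r' ∈ Finset.univ.erase r, u r' ^ p r' :=
      Finset.prod_congr rfl fun r' hr' => by simp [hv, Finset.ne_of_mem_erase hr']
    rw [hcongr, mul_div_right_comm, mul_div_right_comm, mul_le_mul_iff_of_pos_right hC] at hle
    simp only [hvsum] at hle
    have hvr : v r = u r + τ := by simp [hv]
    rw [hvr] at hle
    have hden : ∀ s, 0 < ((∑ r', u r' * f r' s) + τ * f r s) ^ q s :=
      fun s => Real.rpow_pos_of_pos (h3 s) _
    have hden' : ∀ s, 0 < (∑ r', u r' * f r' s) ^ q s :=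
      fun s => Real.rpow_pos_of_pos (hD s) _
    have hnum : 0 < (u r + τ) ^ p r := Real.rpow_pos_of_pos h1 _
    have hlog := Real.log_le_log (div_pos hnum (Finset.prod_pos fun s _ => hden s)) hle
    rw [Real.log_div hnum.ne' (Finset.prod_pos fun s _ => hden s).ne',
      Real.log_div (hur' r).ne' (Finset.prod_pos fun s _ => hden' s).ne',
      Real.log_prod (fun s _ => (hden s).ne'), Real.log_prod (fun s _ => (hden' s).ne'),
      Real.log_rpow h1, Real.log_rpow hur] at hlog
    simp only [Real.log_rpow (h3 _), Real.log_rpow (hD _)] at hlog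
    simpa using hlog
  have hder : HasDerivAt (fun τ : ℝ => p r * Real.log (u r + τ)
      - ∑ s, q s * Real.log ((∑ r', u r' * f r' s) + τ * f r s))
      (p r * (1 / (u r + 0)) - ∑ s, q s * (1 * f r s / ((∑ r', u r' * f r' s) + 0 * f r s))) 0 := by
    refine HasDerivAt.sub ?_ (HasDerivAt.fun_sum fun s _ => ?_)
    · exact (((hasDerivAt_id (0 : ℝ)).const_add (u r)).log (by simpa using hur.ne')).const_mul _
    · exact ((((hasDerivAt_id (0 : ℝ)).mul_const (f r s)).const_add _).log
        (by simpa using (hD s).ne')).const_mul _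
  have h0 := hloc.hasDerivAt_eq_zero hder
  simp only [add_zero, zero_mul, one_mul, ← mul_div_assoc, mul_one] at h0
  rw [← sub_eq_zero.1 h0]
  field_simp

/-- The quotient is continuous up to the boundary of the simplex, since the denominators stay
positive there. -/
lemma exists_isMaxOn_scalingQuotient {p : A → ℝ} {q : B → ℝ} {f : A → B → ℝ}
    (hp : p ∈ stdSimplex ℝ A) (hf : ∀ r s, 0 < f r s) :
    ∃ u ∈ stdSimplex ℝ A, IsMaxOn (scalingQuotient p q f) (stdSimplex ℝ A) u := by
  refine (isCompact_stdSimplex ℝ A).exists_isMaxOn ⟨p, hp⟩ ?_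
  unfold scalingQuotient
  have hD : ∀ u ∈ stdSimplex ℝ A, ∀ s, 0 < ∑ r, u r * f r s := fun u hu s =>
    sum_mul_pos_of_mem_stdSimplex (hf · s) hu
  refine ContinuousOn.div (Continuous.continuousOn ?_) (continuousOn_finsetProd _ fun s _ => ?_)
    fun u hu => (Finset.prod_pos fun s _ => Real.rpow_pos_of_pos (hD u hu s) _).ne'
  · exact continuous_finsetProd _ fun r _ =>
      (continuous_apply r).rpow_const fun _ => Or.inr (hp.1 r)
  · exact ContinuousOn.rpow_const (by fun_prop) fun u hu => Or.inl (hD u hu s).ne'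

/-- A matrix with positive entries can be scaled to have prescribed marginals. -/
lemma exists_scaling [DecidableEq A] {p : A → ℝ} {q : B → ℝ} {f : A → B → ℝ}
    (hp : p ∈ stdSimplex ℝ A)
    (hq : q ∈ stdSimplex ℝ B) (hf : ∀ r s, 0 < f r s) :
    ∃ (x : A → ℝ) (y : B → ℝ), (∀ r, 0 < x r) ∧ (∀ s, 0 < y s) ∧
      (∀ r, ∑ s, x r * f r s * y s * p r * q s = p r) ∧
      ∀ s, ∑ r, x r * f r s * y s * p r * q s = q s := by
  obtain ⟨u, hu, hmax⟩ := exists_isMaxOn_scalingQuotient (q := q) hp hf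
  have hD : ∀ s, 0 < ∑ r, u r * f r s := fun s => sum_mul_pos_of_mem_stdSimplex (hf · s) hu
  have hK : ∀ r, 0 < ∑ s, q s * f r s / (∑ r', u r' * f r' s) := fun r => by
    simpa only [mul_div_assoc] using
      sum_mul_pos_of_mem_stdSimplex (fun s => div_pos (hf r s) (hD s)) hq
  have hstat := fun r => stationary_of_isMaxOn (r := r) hp hq hf hu hmax
  -- Both sides of the stationarity condition have total mass one, so it also holds, in the form
  -- `u r = 0`, for the letters of weight zero.
  have hzero : ∀ r, p r = 0 → u r = 0 := by
    have hnn : ∀ r ∈ Finset.univ,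
        0 ≤ u r * (∑ s, q s * f r s / (∑ r', u r' * f r' s)) - p r := fun r _ => by
      by_cases h : p r = 0
      · rw [h, sub_zero]; exact mul_nonneg (hu.1 r) (hK r).le
      · rw [hstat r h, sub_self]
    have hsum : ∑ r, (u r * (∑ s, q s * f r s / (∑ r', u r' * f r' s)) - p r) = 0 := by
      rw [Finset.sum_sub_distrib, hp.2, sub_eq_zero]
      simp only [Finset.mul_sum]
      rw [Finset.sum_comm, ← hq.2]
      refine Finset.sum_congr rfl fun s _ => ?_
      calc ∑ r, u r * (q s * f r s / ∑ r', u r' * f r' s)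
          = (∑ r, u r * f r s) * (q s / ∑ r', u r' * f r' s) := by
            rw [Finset.sum_mul]
            exact Finset.sum_congr rfl fun r _ => by ring
        _ = q s := mul_div_cancel₀ _ (hD s).ne'
    intro r hr
    have := (Finset.sum_eq_zero_iff_of_nonneg hnn).1 hsum r (Finset.mem_univ r)
    rw [hr, sub_zero] at this
    exact (mul_eq_zero.1 this).resolve_right (hK r).ne'
  have hur : ∀ r, p r ≠ 0 → 0 < u r := fun r hr => (hu.1 r).lt_of_ne' fun h => by
    have := hstat r hr
    rw [h, zero_mul] at this
    exact hr this.symm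
  have hxp : ∀ r, (if p r = 0 then 1 else u r / p r) * p r = u r := fun r => by
    split_ifs with h
    · rw [h, hzero r h, mul_zero]
    · exact div_mul_cancel₀ _ h
  refine ⟨fun r => if p r = 0 then 1 else u r / p r, fun s => (∑ r', u r' * f r' s)⁻¹,
    fun r => ?_, fun s => inv_pos.2 (hD s), fun r => ?_, fun s => ?_⟩
  · dsimp only
    split_ifs with h
    · exact one_pos
    · exact div_pos (hur r h) ((hp.1 r).lt_of_ne' h)
  · by_cases h : p r = 0
    · simp [h]
    · refine Eq.trans ?_ (hstat r h)
      rw [Finset.mul_sum]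
      refine Finset.sum_congr rfl fun s _ => ?_
      linear_combination (f r s * (∑ r', u r' * f r' s)⁻¹ * q s) * hxp r
  · calc _ = ∑ r, (u r * f r s) * ((∑ r', u r' * f r' s)⁻¹ * q s) :=
          Finset.sum_congr rfl fun r _ => by
            linear_combination (f r s * (∑ r', u r' * f r' s)⁻¹ * q s) * hxp r
      _ = q s := by
          rw [← Finset.sum_mul, ← mul_assoc, mul_inv_cancel₀ (hD s).ne', one_mul]

end Scaling

/-! ### Integral tables approximating a real one -/

section TableApproximation

variable {A B : Type*} [Fintype A] [DecidableEq A] [Fintype B] [DecidableEq B]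

lemma tendsto_floor_div_of_tendsto_div {g : ℕ → ℝ} {t : ℝ} (h0 : ∀ n, 0 ≤ g n)
    (h : Tendsto (fun n : ℕ => g n / n) atTop (𝓝 t)) :
    Tendsto (fun n : ℕ => (⌊g n⌋₊ : ℝ) / n) atTop (𝓝 t) := by
  have hl : Tendsto (fun n : ℕ => g n / n - 1 / (n : ℝ)) atTop (𝓝 t) := by
    simpa using h.sub tendsto_one_div_atTop_nhds_zero_nat
  refine tendsto_of_tendsto_of_tendsto_of_le_of_le hl h (fun n => ?_) fun n => ?_
  · dsimp only
    rw [← sub_div]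
    have := (Nat.sub_one_lt_floor (g n)).le
    gcongr
  · have := Nat.floor_le (h0 n)
    dsimp only
    gcongr

/-- If integral margins grow like `n` times the margins of a nonnegative matrix `t`, then they are
the margins of integral tables that grow like `n * t`: rescale `n * t` entrywise so that its row and
column sums stay below the given margins, round down, and fill up the remaining margins, which are
of lower order, arbitrarily. -/
lemma exists_tables_tendsto {t : A → B → ℝ} (ht : ∀ r s, 0 ≤ t r s) {a : ℕ → A → ℕ}
    {b : ℕ → B → ℕ} (hab : ∀ n, ∑ r, a n r = ∑ s, b n s)
    (ha : ∀ r, Tendsto (fun n : ℕ => (a n r : ℝ) / n) atTop (𝓝 (∑ s, t r s)))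
    (hb : ∀ s, Tendsto (fun n : ℕ => (b n s : ℝ) / n) atTop (𝓝 (∑ r, t r s))) :
    ∃ N : ℕ → A → B → ℕ, (∀ n r, ∑ s, N n r s = a n r) ∧ (∀ n s, ∑ r, N n r s = b n s) ∧
      ∀ r s, Tendsto (fun n : ℕ => (N n r s : ℝ) / n) atTop (𝓝 (t r s)) := by
  have hp : ∀ r, 0 ≤ ∑ s, t r s := fun r => Finset.sum_nonneg fun s _ => ht r s
  have hq : ∀ s, 0 ≤ ∑ r, t r s := fun s => Finset.sum_nonneg fun r _ => ht r s
  -- Where a margin of `t` vanishes, `t r s = 0`, so the junk value of the quotient is harmless.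
  set g : ℕ → A → B → ℝ := fun n r s =>
    min (t r s * (a n r / ∑ s', t r s')) (t r s * (b n s / ∑ r', t r' s)) with hg
  have hg0 : ∀ n r s, 0 ≤ g n r s := fun n r s =>
    le_min (mul_nonneg (ht r s) (div_nonneg (Nat.cast_nonneg _) (hp r)))
      (mul_nonneg (ht r s) (div_nonneg (Nat.cast_nonneg _) (hq s)))
  have hglim : ∀ r s, Tendsto (fun n : ℕ => g n r s / n) atTop (𝓝 (t r s)) := fun r s => by
    rcases (ht r s).eq_or_lt with h | h
    · simp [hg, ← h]
    · have hpr : 0 < ∑ s', t r s' :=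
        h.trans_le (Finset.single_le_sum (fun s' _ => ht r s') (Finset.mem_univ s))
      have hqs : 0 < ∑ r', t r' s :=
        h.trans_le (Finset.single_le_sum (fun r' _ => ht r' s) (Finset.mem_univ r))
      have h1 := (((ha r).div_const (∑ s', t r s')).const_mul (t r s)).min
        (((hb s).div_const (∑ r', t r' s)).const_mul (t r s))
      rw [div_self hpr.ne', div_self hqs.ne', mul_one, min_self] at h1
      refine h1.congr fun n => ?_
      rw [hg, ← min_div_div_right (Nat.cast_nonneg n)]
      congr 1 <;> ring
  set M : ℕ → A → B → ℕ := fun n r s => ⌊g n r s⌋₊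
  have hMlim : ∀ r s, Tendsto (fun n : ℕ => (M n r s : ℝ) / n) atTop (𝓝 (t r s)) := fun r s =>
    tendsto_floor_div_of_tendsto_div (fun n => hg0 n r s) (hglim r s)
  have hfrac : ∀ (c : ℕ) (d : ℝ), d * (c / d) ≤ c := fun c d => by
    rcases eq_or_ne d 0 with h | h
    · simp [h]
    · rw [mul_div_cancel₀ _ h]
  have hMa : ∀ n r, ∑ s, M n r s ≤ a n r := fun n r => by
    have : ((∑ s, M n r s : ℕ) : ℝ) ≤ a n r := by
      push_cast
      refine (Finset.sum_le_sum fun s _ => (Nat.floor_le (hg0 n r s)).trans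
        (min_le_left _ _)).trans ?_
      rw [← Finset.sum_mul]
      exact hfrac _ _
    exact_mod_cast this
  have hMb : ∀ n s, ∑ r, M n r s ≤ b n s := fun n s => by
    have : ((∑ r, M n r s : ℕ) : ℝ) ≤ b n s := by
      push_cast
      refine (Finset.sum_le_sum fun r _ => (Nat.floor_le (hg0 n r s)).trans
        (min_le_right _ _)).trans ?_
      rw [← Finset.sum_mul]
      exact hfrac _ _
    exact_mod_cast this
  have hres : ∀ n, ∑ r, (a n r - ∑ s, M n r s) = ∑ s, (b n s - ∑ r, M n r s) := fun n => by
    rw [Finset.sum_tsub_distrib _ (fun r _ => hMa n r),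
      Finset.sum_tsub_distrib _ (fun s _ => hMb n s),
      hab n, Finset.sum_comm]
  choose R hR1 hR2 using fun n => exists_table (fun r => a n r - ∑ s, M n r s)
    (fun s => b n s - ∑ r, M n r s) (hres n)
  refine ⟨fun n r s => M n r s + R n r s, fun n r => ?_, fun n s => ?_, fun r s => ?_⟩
  · rw [Finset.sum_add_distrib, hR1]
    exact Nat.add_sub_of_le (hMa n r)
  · rw [Finset.sum_add_distrib, hR2]
    exact Nat.add_sub_of_le (hMb n s)
  · have hup : Tendsto (fun n : ℕ => (a n r : ℝ) / n - ∑ s, (M n r s : ℝ) / n) atTop (𝓝 0) := by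
      simpa using (ha r).sub (tendsto_finsetSum Finset.univ fun s _ => hMlim r s)
    have hRlim : Tendsto (fun n : ℕ => (R n r s : ℝ) / n) atTop (𝓝 0) := by
      refine tendsto_of_tendsto_of_tendsto_of_le_of_le tendsto_const_nhds hup
        (fun n => by positivity) fun n => ?_
      have h1 : R n r s ≤ a n r - ∑ s, M n r s := by
        rw [← hR1 n r]
        exact Finset.single_le_sum (f := fun s => R n r s) (fun _ _ => Nat.zero_le _)
          (Finset.mem_univ s)
      have h2 : (R n r s : ℝ) ≤ a n r - ∑ s, (M n r s : ℝ) := by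
        have h3 : (R n r s : ℝ) ≤ ((a n r - ∑ s, M n r s : ℕ) : ℝ) := by exact_mod_cast h1
        rw [Nat.cast_sub (hMa n r)] at h3
        exact_mod_cast h3
      dsimp only
      rw [← Finset.sum_div, ← sub_div]
      gcongr
    simpa [add_div] using (hMlim r s).add hRlim

end TableApproximation

/-! ### The growth rate of the permanent -/

section Limit

variable {A B : Type*} [Fintype A] [DecidableEq A] [Fintype B] [DecidableEq B]

lemma permanent_pos {ι : Type*} [Fintype ι] [DecidableEq ι] {M : Matrix ι ι ℝ}
    (hM : ∀ i j, 0 < M i j) : 0 < M.permanent :=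
  Finset.sum_pos (fun _ _ => Finset.prod_pos fun _ _ => hM _ _) Finset.univ_nonempty

/-- The value at `(x, y)` of the functional whose infimum is the scaling mean. -/
noncomputable def scalingFunctional (p : A → ℝ) (q : B → ℝ) (f : A → B → ℝ) (x : A → ℝ)
    (y : B → ℝ) : ℝ :=
  (∏ r, x r ^ (-p r)) * (∏ s, y s ^ (-q s)) * ∑ r, ∑ s, x r * f r s * y s * p r * q s

omit [DecidableEq A] [DecidableEq B] in
lemma scalingFunctional_sum_pos {p : A → ℝ} {q : B → ℝ} {f : A → B → ℝ}
    (hp : p ∈ stdSimplex ℝ A) (hq : q ∈ stdSimplex ℝ B) (hf : ∀ r s, 0 < f r s) {x : A → ℝ}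
    {y : B → ℝ} (hx : ∀ r, 0 < x r) (hy : ∀ s, 0 < y s) :
    0 < ∑ r, ∑ s, x r * f r s * y s * p r * q s := by
  have := sum_mul_pos_of_mem_stdSimplex (f := fun r => x r * ∑ s, q s * (f r s * y s))
    (fun r => mul_pos (hx r) (sum_mul_pos_of_mem_stdSimplex
      (fun s => mul_pos (hf r s) (hy s)) hq)) hp
  refine this.trans_eq (Finset.sum_congr rfl fun r _ => ?_)
  rw [Finset.mul_sum, Finset.mul_sum]
  exact Finset.sum_congr rfl fun s _ => by ring

omit [DecidableEq A] [DecidableEq B] in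
lemma scalingFunctional_pos {p : A → ℝ} {q : B → ℝ} {f : A → B → ℝ}
    (hp : p ∈ stdSimplex ℝ A) (hq : q ∈ stdSimplex ℝ B) (hf : ∀ r s, 0 < f r s) {x : A → ℝ}
    {y : B → ℝ} (hx : ∀ r, 0 < x r) (hy : ∀ s, 0 < y s) :
    0 < scalingFunctional p q f x y :=
  mul_pos (mul_pos (Finset.prod_pos fun r _ => Real.rpow_pos_of_pos (hx r) _)
    (Finset.prod_pos fun s _ => Real.rpow_pos_of_pos (hy s) _))
    (scalingFunctional_sum_pos hp hq hf hx hy)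

omit [DecidableEq A] [DecidableEq B] in
lemma log_scalingFunctional {p : A → ℝ} {q : B → ℝ} {f : A → B → ℝ}
    (hp : p ∈ stdSimplex ℝ A) (hq : q ∈ stdSimplex ℝ B) (hf : ∀ r s, 0 < f r s) {x : A → ℝ}
    {y : B → ℝ} (hx : ∀ r, 0 < x r) (hy : ∀ s, 0 < y s) :
    Real.log (scalingFunctional p q f x y) = -(∑ r, p r * Real.log (x r))
      - (∑ s, q s * Real.log (y s)) + Real.log (∑ r, ∑ s, x r * f r s * y s * p r * q s) := by
  have h1 : ∀ r, 0 < x r ^ (-p r) := fun r => Real.rpow_pos_of_pos (hx r) _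
  have h2 : ∀ s, 0 < y s ^ (-q s) := fun s => Real.rpow_pos_of_pos (hy s) _
  unfold scalingFunctional
  rw [Real.log_mul (mul_pos (Finset.prod_pos fun r _ => h1 r)
      (Finset.prod_pos fun s _ => h2 s)).ne' (scalingFunctional_sum_pos hp hq hf hx hy).ne',
    Real.log_mul (Finset.prod_pos fun r _ => h1 r).ne' (Finset.prod_pos fun s _ => h2 s).ne',
    Real.log_prod (fun r _ => (h1 r).ne'), Real.log_prod (fun s _ => (h2 s).ne')]
  simp only [Real.log_rpow (hx _), Real.log_rpow (hy _), neg_mul, Finset.sum_neg_distrib]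
  ring

/-- The number of occurrences of the letter `r` among the first `n` letters of `w`. -/
def prefixCount (w : ℕ → A) (n : ℕ) (r : A) : ℕ := letterCount (fun i : Fin n => w i) r

lemma sum_prefixCount (w : ℕ → A) (n : ℕ) : ∑ r, prefixCount w n r = n := by
  simpa [prefixCount] using sum_letterCount fun i : Fin n => w i

/-- The matrix of the values of `f` at the first `n` letters of two sequences. -/
def letterMatrix (f : A → B → ℝ) (w : ℕ → A) (m : ℕ → B) (n : ℕ) : Matrix (Fin n) (Fin n) ℝ :=
  Matrix.of fun i j => f (w i) (m j)

omit [Fintype A] [DecidableEq A] [Fintype B] [DecidableEq B] in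
lemma log_permanent_div_factorial {f : A → B → ℝ} (hf : ∀ r s, 0 < f r s) (w : ℕ → A)
    (m : ℕ → B) (n : ℕ) :
    Real.log ((letterMatrix f w m n).permanent / (n ! : ℝ))
      = Real.log (letterMatrix f w m n).permanent - Real.log (n ! : ℝ) :=
  Real.log_div (permanent_pos fun _ _ => hf _ _).ne' (by positivity)

lemma sum_log_factorial_prefixCount_div (w : ℕ → A) (n : ℕ) :
    (∑ r, Real.log ((prefixCount w n r)! : ℝ)) / n
      = ∑ r, (Real.log ((prefixCount w n r)! : ℝ) - prefixCount w n r * Real.log n) / n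
        + n * Real.log n / n := by
  rw [← Finset.sum_div, ← add_div, Finset.sum_sub_distrib, ← Finset.sum_mul]
  congr 1
  rw [← Nat.cast_sum, sum_prefixCount]
  ring

lemma tendsto_log_factorial_self :
    Tendsto (fun n : ℕ => (Real.log (n ! : ℝ) - n * Real.log n) / n) atTop (𝓝 (-1)) := by
  have h : Tendsto (fun n : ℕ => ((id n : ℕ) : ℝ) / n) atTop (𝓝 1) :=
    tendsto_const_nhds.congr' (by
      filter_upwards [eventually_ne_atTop 0] with n hn
      exact (div_self (Nat.cast_ne_zero.2 hn)).symm)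
  simpa using tendsto_log_factorial h

omit [Fintype A] [DecidableEq A] in
lemma log_prod_pow {ι : Type*} [Fintype ι] {u : ι → ℝ} {k : ι → ℕ}
    (hu : ∀ r, u r = 0 → k r = 0) :
    Real.log (∏ r, u r ^ k r) = ∑ r, k r * Real.log (u r) := by
  rw [Real.log_prod fun r _ => ?_]
  · simp only [Real.log_pow]
  · intro h
    rcases pow_eq_zero_iff'.1 h with ⟨h1, h2⟩
    exact h2 (hu r h1)

/-- Upper bound for the exponential growth rate of the permanent, from the generating-function
bound at `u = x * p`, `v = y * q`. -/
lemma exists_upper_tendsto {p : A → ℝ} {q : B → ℝ} {f : A → B → ℝ}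
    (hp : p ∈ stdSimplex ℝ A) (hq : q ∈ stdSimplex ℝ B) (hf : ∀ r s, 0 < f r s)
    {w : ℕ → A} {m : ℕ → B} (hw0 : ∀ i, p (w i) ≠ 0) (hm0 : ∀ j, q (m j) ≠ 0)
    (hw : ∀ r, Tendsto (fun n : ℕ => (prefixCount w n r : ℝ) / n) atTop (𝓝 (p r)))
    (hm : ∀ s, Tendsto (fun n : ℕ => (prefixCount m n s : ℝ) / n) atTop (𝓝 (q s)))
    {x : A → ℝ} {y : B → ℝ} (hx : ∀ r, 0 < x r) (hy : ∀ s, 0 < y s) :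
    ∃ U : ℕ → ℝ, Tendsto U atTop (𝓝 (Real.log (scalingFunctional p q f x y))) ∧
      ∀ᶠ n in atTop, Real.log ((letterMatrix f w m n).permanent / (n ! : ℝ)) / n ≤ U n := by
  set S : ℝ := ∑ r, ∑ s, x r * f r s * y s * p r * q s with hS
  have hSpos : 0 < S := scalingFunctional_sum_pos hp hq hf hx hy
  -- All factorials are normalized by powers of `n`, whose exponents cancel because the letter
  -- counts of a prefix of length `n` add up to `n`.
  refine ⟨fun n =>
    ∑ r, (Real.log ((prefixCount w n r)! : ℝ) - prefixCount w n r * Real.log n) / n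
    + ∑ s, (Real.log ((prefixCount m n s)! : ℝ) - prefixCount m n s * Real.log n) / n
    - 2 * ((Real.log (n ! : ℝ) - n * Real.log n) / n)
    + Real.log S - ∑ r, (prefixCount w n r : ℝ) / n * Real.log (x r * p r)
    - ∑ s, (prefixCount m n s : ℝ) / n * Real.log (y s * q s), ?_, ?_⟩
  · have hlim := (((((tendsto_finsetSum Finset.univ fun r _ => tendsto_log_factorial (hw r)).add
      (tendsto_finsetSum Finset.univ fun s _ => tendsto_log_factorial (hm s))).sub
      (tendsto_log_factorial_self.const_mul 2)).add_const (Real.log S)).sub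
      (tendsto_finsetSum Finset.univ fun r _ => (hw r).mul_const (Real.log (x r * p r)))).sub
      (tendsto_finsetSum Finset.univ fun s _ => (hm s).mul_const (Real.log (y s * q s)))
    convert hlim using 2
    rw [log_scalingFunctional hp hq hf hx hy, ← hS]
    have h1 : ∀ r, p r * Real.log (x r * p r) = p r * Real.log (x r) + p r * Real.log (p r) :=
      fun r => by
        by_cases h : p r = 0
        · simp [h]
        · rw [Real.log_mul (hx r).ne' h, mul_add]
    have h2 : ∀ s, q s * Real.log (y s * q s) = q s * Real.log (y s) + q s * Real.log (q s) :=
      fun s => by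
        by_cases h : q s = 0
        · simp [h]
        · rw [Real.log_mul (hy s).ne' h, mul_add]
    simp only [h1, h2, Finset.sum_add_distrib, Finset.sum_sub_distrib, hp.2, hq.2]
    ring
  · filter_upwards [eventually_gt_atTop 0] with n hn
    have hn' : (0 : ℝ) < n := by positivity
    have hbound := permanent_mul_le f (fun r s => (hf r s).le) (fun i : Fin n => w i)
      (fun j : Fin n => m j) (u := fun r => x r * p r) (v := fun s => y s * q s)
      (fun r => mul_nonneg (hx r).le (hp.1 r)) (fun s => mul_nonneg (hy s).le (hq.1 s))
    have hSS : ∑ r, ∑ s, x r * p r * f r s * (y s * q s) = S :=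
      Finset.sum_congr rfl fun r _ => Finset.sum_congr rfl fun s _ => by ring
    have hper : 0 < (letterMatrix f w m n).permanent := permanent_pos fun _ _ => hf _ _
    -- A letter of weight zero does not occur, so the monomial at `u = x * p`, `v = y * q` is
    -- positive (with `0 ^ 0 = 1`).
    have ha : ∀ r, x r * p r = 0 → prefixCount w n r = 0 := fun r h => by
      have hpr := (mul_eq_zero.1 h).resolve_left (hx r).ne'
      unfold prefixCount letterCount
      refine Finset.card_eq_zero.2 (Finset.filter_eq_empty_iff.2 fun i _ hi => hw0 i ?_)
      exact (congrArg p hi).trans hpr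
    have hb : ∀ s, y s * q s = 0 → prefixCount m n s = 0 := fun s h => by
      have hqs := (mul_eq_zero.1 h).resolve_left (hy s).ne'
      unfold prefixCount letterCount
      refine Finset.card_eq_zero.2 (Finset.filter_eq_empty_iff.2 fun i _ hi => hm0 i ?_)
      exact (congrArg q hi).trans hqs
    have hua : 0 < ∏ r, (x r * p r) ^ prefixCount w n r := Finset.prod_pos fun r _ => by
      rcases (mul_nonneg (hx r).le (hp.1 r)).eq_or_lt with h | h
      · rw [ha r h.symm, pow_zero]; exact one_pos
      · exact pow_pos h _
    have hvb : 0 < ∏ s, (y s * q s) ^ prefixCount m n s := Finset.prod_pos fun s _ => by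
      rcases (mul_nonneg (hy s).le (hq.1 s)).eq_or_lt with h | h
      · rw [hb s h.symm, pow_zero]; exact one_pos
      · exact pow_pos h _
    rw [hSS, Fintype.card_fin] at hbound
    change (n ! : ℝ) * (letterMatrix f w m n).permanent *
      ((∏ r, (x r * p r) ^ prefixCount w n r) * ∏ s, (y s * q s) ^ prefixCount m n s)
      ≤ (∏ r, ((prefixCount w n r)! : ℝ)) * (∏ s, ((prefixCount m n s)! : ℝ)) * S ^ n at hbound
    have hfac : (0 : ℝ) < (n ! : ℝ) := by positivity
    have hfa : ∀ r, (0 : ℝ) < ((prefixCount w n r)! : ℝ) := fun r => by positivity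
    have hfb : ∀ s, (0 : ℝ) < ((prefixCount m n s)! : ℝ) := fun s => by positivity
    have hPa := Finset.prod_pos fun r (_ : r ∈ Finset.univ) => hfa r
    have hPb := Finset.prod_pos fun s (_ : s ∈ Finset.univ) => hfb s
    have hlog := Real.log_le_log (by positivity) hbound
    rw [Real.log_mul (by positivity) (by positivity), Real.log_mul hfac.ne' hper.ne',
      Real.log_mul hua.ne' hvb.ne', log_prod_pow ha, log_prod_pow hb,
      Real.log_mul (by positivity) (by positivity), Real.log_mul hPa.ne' hPb.ne',
      Real.log_prod (fun r _ => (hfa r).ne'), Real.log_prod (fun s _ => (hfb s).ne'),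
      Real.log_pow] at hlog
    have hkey : Real.log ((letterMatrix f w m n).permanent / (n ! : ℝ)) / n
        ≤ ((∑ r, Real.log ((prefixCount w n r)! : ℝ)) + (∑ s, Real.log ((prefixCount m n s)! : ℝ))
          + n * Real.log S - 2 * Real.log (n ! : ℝ)
          - (∑ r, prefixCount w n r * Real.log (x r * p r))
          - ∑ s, prefixCount m n s * Real.log (y s * q s)) / n := by
      rw [log_permanent_div_factorial hf]
      refine div_le_div_of_nonneg_right ?_ hn'.le
      linarith
    refine hkey.trans_eq ?_
    have hself : (Real.log (n ! : ℝ) - n * Real.log n) / n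
        = Real.log (n ! : ℝ) / n - Real.log n := by
      rw [sub_div, mul_div_cancel_left₀ _ hn'.ne']
    rw [hself, sub_div _ _ (n : ℝ), sub_div _ _ (n : ℝ), sub_div _ _ (n : ℝ), add_div _ _ (n : ℝ),
      add_div _ _ (n : ℝ), sum_log_factorial_prefixCount_div, sum_log_factorial_prefixCount_div]
    simp only [mul_div_cancel_left₀ _ hn'.ne', Finset.sum_div _ (fun r => _ * _),
      mul_div_right_comm]
    ring

/-- Lower bound for the exponential growth rate of the permanent, from the tables close to
`n` times a scaling of `f` with marginals `p` and `q`. -/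
lemma exists_lower_tendsto {p : A → ℝ} {q : B → ℝ} {f : A → B → ℝ}
    (hp : p ∈ stdSimplex ℝ A) (hq : q ∈ stdSimplex ℝ B) (hf : ∀ r s, 0 < f r s)
    {w : ℕ → A} {m : ℕ → B}
    (hw : ∀ r, Tendsto (fun n : ℕ => (prefixCount w n r : ℝ) / n) atTop (𝓝 (p r)))
    (hm : ∀ s, Tendsto (fun n : ℕ => (prefixCount m n s : ℝ) / n) atTop (𝓝 (q s)))
    {x : A → ℝ} {y : B → ℝ} (hx : ∀ r, 0 < x r) (hy : ∀ s, 0 < y s)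
    (hrow : ∀ r, ∑ s, x r * f r s * y s * p r * q s = p r)
    (hcol : ∀ s, ∑ r, x r * f r s * y s * p r * q s = q s) :
    ∃ V : ℕ → ℝ, Tendsto V atTop (𝓝 (Real.log (scalingFunctional p q f x y))) ∧
      ∀ᶠ n in atTop, V n ≤ Real.log ((letterMatrix f w m n).permanent / (n ! : ℝ)) / n := by
  set t : A → B → ℝ := fun r s => x r * f r s * y s * p r * q s with ht
  have ht0 : ∀ r s, 0 ≤ t r s := fun r s => by
    have := hx r; have := hf r s; have := hy s; have := hp.1 r; have := hq.1 s
    positivity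
  obtain ⟨N, hNw, hNm, hNlim⟩ := exists_tables_tendsto ht0
    (a := prefixCount w) (b := prefixCount m)
    (fun n => by rw [sum_prefixCount, sum_prefixCount])
    (fun r => by rw [hrow r]; exact hw r) (fun s => by rw [hcol s]; exact hm s)
  -- All factorials are normalized by powers of `n`, whose exponents cancel because the letter
  -- counts of a prefix of length `n` add up to `n`.
  refine ⟨fun n =>
    ∑ r, (Real.log ((prefixCount w n r)! : ℝ) - prefixCount w n r * Real.log n) / n
    + ∑ s, (Real.log ((prefixCount m n s)! : ℝ) - prefixCount m n s * Real.log n) / n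
    - ∑ r, ∑ s, (Real.log ((N n r s)! : ℝ) - N n r s * Real.log n) / n
    - (Real.log (n ! : ℝ) - n * Real.log n) / n
    + ∑ r, ∑ s, (N n r s : ℝ) / n * Real.log (f r s), ?_, ?_⟩
  · have hlim := (((((tendsto_finsetSum Finset.univ fun r _ => tendsto_log_factorial (hw r)).add
      (tendsto_finsetSum Finset.univ fun s _ => tendsto_log_factorial (hm s))).sub
      (tendsto_finsetSum Finset.univ fun r _ => tendsto_finsetSum Finset.univ fun s _ =>
        tendsto_log_factorial (hNlim r s))).sub tendsto_log_factorial_self).add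
      (tendsto_finsetSum Finset.univ fun r _ => tendsto_finsetSum Finset.univ fun s _ =>
        (hNlim r s).mul_const (Real.log (f r s))))
    convert hlim using 2
    rw [log_scalingFunctional hp hq hf hx hy]
    have hone : ∑ r, ∑ s, t r s = 1 := by
      rw [← hp.2]; exact Finset.sum_congr rfl fun r _ => hrow r
    have h1 : ∀ r s, t r s * Real.log (t r s) = t r s * Real.log (x r) + t r s * Real.log (f r s)
        + t r s * Real.log (y s) + t r s * Real.log (p r) + t r s * Real.log (q s) := fun r s => by
      by_cases h : t r s = 0
      · simp [h]
      · have hpr : p r ≠ 0 := fun h' => h (by simp [ht, h'])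
        have hqs : q s ≠ 0 := fun h' => h (by simp [ht, h'])
        have hxr := (hx r).ne'
        have hys := (hy s).ne'
        have hfr := (hf r s).ne'
        have : Real.log (t r s) = Real.log (x r) + Real.log (f r s) + Real.log (y s)
            + Real.log (p r) + Real.log (q s) := by
          rw [ht, Real.log_mul (by positivity) hqs, Real.log_mul (by positivity) hpr,
            Real.log_mul (by positivity) hys, Real.log_mul hxr hfr]
        rw [this]
        ring
    have hr : ∀ g : A → ℝ, ∑ r, ∑ s, t r s * g r = ∑ r, p r * g r := fun g =>
      Finset.sum_congr rfl fun r _ => by rw [← Finset.sum_mul, hrow r]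
    have hs : ∀ g : B → ℝ, ∑ r, ∑ s, t r s * g s = ∑ s, q s * g s := fun g => by
      rw [Finset.sum_comm]
      exact Finset.sum_congr rfl fun s _ => by rw [← Finset.sum_mul, hcol s]
    change _ + Real.log (∑ r, ∑ s, t r s) = _
    simp only [h1, Finset.sum_add_distrib, Finset.sum_sub_distrib, hp.2, hq.2, hone, hr, hs]
    rw [Real.log_one]
    ring
  · filter_upwards [eventually_gt_atTop 0] with n hn
    have hn' : (0 : ℝ) < n := by positivity
    have hbound := le_permanent_of_table f (fun r s => (hf r s).le) (fun i : Fin n => w i)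
      (fun j : Fin n => m j) (N n) (hNw n) (hNm n)
    change (∏ r, ((prefixCount w n r)! : ℝ)) * (∏ s, ((prefixCount m n s)! : ℝ)) *
        ∏ r, ∏ s, f r s ^ N n r s
      ≤ (∏ r, ∏ s, ((N n r s)! : ℝ)) * (letterMatrix f w m n).permanent at hbound
    have hper : 0 < (letterMatrix f w m n).permanent := permanent_pos fun _ _ => hf _ _
    have hfa : ∀ r, (0 : ℝ) < ((prefixCount w n r)! : ℝ) := fun r => by positivity
    have hfb : ∀ s, (0 : ℝ) < ((prefixCount m n s)! : ℝ) := fun s => by positivity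
    have hfN : ∀ r s, (0 : ℝ) < ((N n r s)! : ℝ) := fun r s => by positivity
    have hff : ∀ r s, (0 : ℝ) < f r s ^ N n r s := fun r s => pow_pos (hf r s) _
    have hPa := Finset.prod_pos fun r (_ : r ∈ Finset.univ) => hfa r
    have hPb := Finset.prod_pos fun s (_ : s ∈ Finset.univ) => hfb s
    have hPN' := fun r => Finset.prod_pos fun s (_ : s ∈ Finset.univ) => hfN r s
    have hPN := Finset.prod_pos fun r (_ : r ∈ Finset.univ) => hPN' r
    have hPf' := fun r => Finset.prod_pos fun s (_ : s ∈ Finset.univ) => hff r s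
    have hPf := Finset.prod_pos fun r (_ : r ∈ Finset.univ) => hPf' r
    have hlog := Real.log_le_log (by positivity) hbound
    rw [Real.log_mul (by positivity) hPf.ne', Real.log_mul hPa.ne' hPb.ne',
      Real.log_mul hPN.ne' hper.ne',
      Real.log_prod (fun r _ => (hfa r).ne'), Real.log_prod (fun s _ => (hfb s).ne'),
      Real.log_prod (fun r _ => (hPf' r).ne'), Real.log_prod (fun r _ => (hPN' r).ne')] at hlog
    simp only [Real.log_prod (fun s _ => (hff _ s).ne'), Real.log_prod (fun s _ => (hfN _ s).ne'),
      Real.log_pow] at hlog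
    have hkey : ((∑ r, Real.log ((prefixCount w n r)! : ℝ))
          + (∑ s, Real.log ((prefixCount m n s)! : ℝ))
          - (∑ r, ∑ s, Real.log ((N n r s)! : ℝ)) - Real.log (n ! : ℝ)
          + ∑ r, ∑ s, N n r s * Real.log (f r s)) / n
        ≤ Real.log ((letterMatrix f w m n).permanent / (n ! : ℝ)) / n := by
      rw [log_permanent_div_factorial hf]
      refine div_le_div_of_nonneg_right ?_ hn'.le
      linarith
    refine le_of_eq_of_le ?_ hkey
    have hNsum : (∑ r, ∑ s, Real.log ((N n r s)! : ℝ)) / n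
        = ∑ r, ∑ s, (Real.log ((N n r s)! : ℝ) - N n r s * Real.log n) / n
          + n * Real.log n / n := by
      simp only [← Finset.sum_div, ← add_div, Finset.sum_sub_distrib, ← Finset.sum_mul]
      have : (∑ r, ∑ s, (N n r s : ℝ)) = n := by
        simp only [← Nat.cast_sum, hNw, sum_prefixCount]
      rw [this]
      ring
    have hself : (Real.log (n ! : ℝ) - n * Real.log n) / n
        = Real.log (n ! : ℝ) / n - Real.log n := by
      rw [sub_div, mul_div_cancel_left₀ _ hn'.ne']
    rw [hself, add_div _ _ (n : ℝ), sub_div _ _ (n : ℝ), sub_div _ _ (n : ℝ),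
      add_div _ _ (n : ℝ), sum_log_factorial_prefixCount_div, sum_log_factorial_prefixCount_div,
      hNsum]
    simp only [mul_div_cancel_left₀ _ hn'.ne', Finset.sum_div _ (fun r => ∑ s, _ * _),
      Finset.sum_div _ (fun s => _ * _), mul_div_right_comm]
    ring

/-- The exponential growth rate of the permanent for deterministic sequences with letter
frequencies `p` and `q` is the scaling mean. -/
lemma tendsto_permanent_rpow {p : A → ℝ} {q : B → ℝ} {f : A → B → ℝ}
    (hp : p ∈ stdSimplex ℝ A) (hq : q ∈ stdSimplex ℝ B) (hf : ∀ r s, 0 < f r s)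
    {w : ℕ → A} {m : ℕ → B} (hw0 : ∀ i, p (w i) ≠ 0) (hm0 : ∀ j, q (m j) ≠ 0)
    (hw : ∀ r, Tendsto (fun n : ℕ => (prefixCount w n r : ℝ) / n) atTop (𝓝 (p r)))
    (hm : ∀ s, Tendsto (fun n : ℕ => (prefixCount m n s : ℝ) / n) atTop (𝓝 (q s))) :
    Tendsto (fun n : ℕ => ((letterMatrix f w m n).permanent / (n ! : ℝ)) ^ (1 / (n : ℝ))) atTop
      (𝓝 (⨅ z : {x : A → ℝ // ∀ r, 0 < x r} × {y : B → ℝ // ∀ s, 0 < y s},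
        scalingFunctional p q f z.1.1 z.2.1)) := by
  obtain ⟨x, y, hx, hy, hrow, hcol⟩ := exists_scaling hp hq hf
  obtain ⟨V, hV, hVle⟩ := exists_lower_tendsto hp hq hf hw hm hx hy hrow hcol
  have hmin : ∀ z : {x : A → ℝ // ∀ r, 0 < x r} × {y : B → ℝ // ∀ s, 0 < y s},
      scalingFunctional p q f x y ≤ scalingFunctional p q f z.1.1 z.2.1 := fun z => by
    obtain ⟨U, hU, hUle⟩ := exists_upper_tendsto hp hq hf hw0 hm0 hw hm z.1.2 z.2.2
    have h := le_of_tendsto_of_tendsto hV hU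
      (by filter_upwards [hVle, hUle] with n h1 h2 using h1.trans h2)
    exact (Real.log_le_log_iff (scalingFunctional_pos hp hq hf hx hy)
      (scalingFunctional_pos hp hq hf z.1.2 z.2.2)).1 h
  have hinf : (⨅ z : {x : A → ℝ // ∀ r, 0 < x r} × {y : B → ℝ // ∀ s, 0 < y s},
      scalingFunctional p q f z.1.1 z.2.1) = scalingFunctional p q f x y := by
    have : Nonempty ({x : A → ℝ // ∀ r, 0 < x r} × {y : B → ℝ // ∀ s, 0 < y s}) :=
      ⟨(⟨x, hx⟩, ⟨y, hy⟩)⟩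
    refine le_antisymm ?_ (le_ciInf hmin)
    have hbdd : BddBelow (Set.range fun z : {x : A → ℝ // ∀ r, 0 < x r} ×
        {y : B → ℝ // ∀ s, 0 < y s} => scalingFunctional p q f z.1.1 z.2.1) :=
      ⟨scalingFunctional p q f x y, by rintro _ ⟨z, rfl⟩; exact hmin z⟩
    exact ciInf_le hbdd (⟨x, hx⟩, ⟨y, hy⟩)
  rw [hinf]
  obtain ⟨U, hU, hUle⟩ := exists_upper_tendsto hp hq hf hw0 hm0 hw hm hx hy
  have hlog := tendsto_of_tendsto_of_tendsto_of_le_of_le' hV hU hVle hUle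
  have hexp := (Real.continuous_exp.tendsto _).comp hlog
  rw [Real.exp_log (scalingFunctional_pos hp hq hf hx hy)] at hexp
  refine hexp.congr fun n => ?_
  have hper : 0 < (letterMatrix f w m n).permanent := permanent_pos fun _ _ => hf _ _
  rw [Real.rpow_def_of_pos (by positivity)]
  simp [div_eq_mul_inv]

end Limit

/-! ### Letter frequencies of random sequences -/

section LawOfLargeNumbers

variable {k : ℕ}

lemma letterLaw_singleton (p : stdSimplex ℝ (Fin k)) (r : Fin k) :
    letterLaw p {r} = ENNReal.ofReal (p r) := by
  simp [letterLaw, Set.indicator_apply]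

lemma prefixCount_eq_sum_indicator (w : ℕ → Fin k) (n : ℕ) (r : Fin k) :
    (prefixCount w n r : ℝ) = ∑ i ∈ Finset.range n, ({r} : Set (Fin k)).indicator 1 (w i) := by
  unfold prefixCount letterCount
  rw [Finset.card_filter, Nat.cast_sum,
    ← Fin.sum_univ_eq_sum_range (fun i => ({r} : Set (Fin k)).indicator (1 : Fin k → ℝ) (w i))]
  refine Finset.sum_congr rfl fun i _ => ?_
  by_cases h : w i = r <;> simp [h]

/-- The strong law of large numbers for the frequency of a letter. -/
lemma ae_tendsto_prefixCount_div (p : stdSimplex ℝ (Fin k)) (r : Fin k) :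
    ∀ᵐ w ∂(bernoulliShift p),
      Tendsto (fun n : ℕ => (prefixCount w n r : ℝ) / n) atTop (𝓝 (p r)) := by
  set f : Fin k → ℝ := ({r} : Set (Fin k)).indicator 1 with hf
  have hfm : Measurable f := Measurable.of_discrete
  have hev : ∀ i, MeasurePreserving (fun w : ℕ → Fin k => w i) (bernoulliShift p) (letterLaw p) :=
    fun i => measurePreserving_eval_infinitePi (fun _ => letterLaw p) i
  have hint : Integrable (fun w : ℕ → Fin k => f (w 0)) (bernoulliShift p) :=
    (hev 0).integrable_comp_of_integrable (g := f) Integrable.of_finite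
  have hind : Pairwise (Function.onFun (fun X Y => IndepFun X Y (bernoulliShift p))
      (fun i (w : ℕ → Fin k) => f (w i))) := fun i j hij =>
    (iIndepFun_infinitePi (P := fun _ : ℕ => letterLaw p) (X := fun _ => f)
      fun _ => hfm).indepFun hij
  have hid : ∀ i, IdentDistrib (fun w : ℕ → Fin k => f (w i)) (fun w => f (w 0))
      (bernoulliShift p) (bernoulliShift p) := fun i =>
    (IdentDistrib.mk (hev i).measurable.aemeasurable (hev 0).measurable.aemeasurable
      ((hev i).map_eq.trans (hev 0).map_eq.symm)).comp hfm
  have hmean : ∫ w, f (w 0) ∂(bernoulliShift p) = p r := by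
    rw [← integral_map (hev 0).measurable.aemeasurable hfm.aestronglyMeasurable (f := f),
      (hev 0).map_eq, hf, integral_indicator_one (MeasurableSet.singleton r), measureReal_def,
      letterLaw_singleton]
    exact ENNReal.toReal_ofReal (p.2.1 r)
  have h := strong_law_ae_real (fun i (w : ℕ → Fin k) => f (w i)) hint hind hid
  filter_upwards [h] with w hw
  rw [hmean] at hw
  simpa only [prefixCount_eq_sum_indicator] using hw

/-- Almost surely every letter that occurs has positive weight. -/
lemma ae_weight_ne_zero (p : stdSimplex ℝ (Fin k)) :
    ∀ᵐ w ∂(bernoulliShift p), ∀ i, p (w i) ≠ 0 := by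
  refine ae_all_iff.2 fun i => ?_
  have hev : MeasurePreserving (fun w : ℕ → Fin k => w i) (bernoulliShift p) (letterLaw p) :=
    measurePreserving_eval_infinitePi (fun _ => letterLaw p) i
  refine hev.quasiMeasurePreserving.ae (p := fun r => p r ≠ 0) ?_
  refine ae_iff_of_countable.2 fun r hr => ?_
  rw [letterLaw_singleton] at hr
  intro h
  simp [h] at hr

end LawOfLargeNumbers

/-! ### The expected number of perfect matchings -/

section ExpectedMatchings

variable {n : ℕ}

lemma bipartiteGraph_adj_inl {x : Fin n × Fin n → Bool} {i : Fin n} {v : Fin n ⊕ Fin n} :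
    (bipartiteGraph x).Adj (Sum.inl i) v ↔ ∃ j, v = Sum.inr j ∧ x (i, j) = true := by
  unfold bipartiteGraph
  rw [SimpleGraph.fromRel_adj]
  constructor
  · rintro ⟨-, ⟨i', j, h1, h2, h3⟩ | ⟨i', j, h1, h2, h3⟩⟩
    · rw [Sum.inl.inj h1]; exact ⟨j, h2, h3⟩
    · simp at h2
  · rintro ⟨j, rfl, h⟩
    exact ⟨by simp, Or.inl ⟨i, j, rfl, rfl, h⟩⟩

lemma bipartiteGraph_adj_inr {x : Fin n × Fin n → Bool} {j : Fin n} {v : Fin n ⊕ Fin n} :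
    (bipartiteGraph x).Adj (Sum.inr j) v ↔ ∃ i, v = Sum.inl i ∧ x (i, j) = true := by
  rw [SimpleGraph.adj_comm]
  rcases v with i | j'
  · rw [bipartiteGraph_adj_inl]
    simp
  · simp only [reduceCtorEq, false_and, exists_false, iff_false]
    intro h
    simp [bipartiteGraph] at h

/-- The perfect matching of the bipartite graph given by a permutation all of whose edges
`(i, τ i)` are present. -/
def matchingOfPerm (x : Fin n × Fin n → Bool) (τ : Equiv.Perm (Fin n))
    (hτ : ∀ i, x (i, τ i) = true) : (bipartiteGraph x).Subgraph where
  verts := Set.univ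
  Adj u v := (∃ i, u = Sum.inl i ∧ v = Sum.inr (τ i)) ∨ ∃ i, v = Sum.inl i ∧ u = Sum.inr (τ i)
  adj_sub := by
    rintro u v (⟨i, rfl, rfl⟩ | ⟨i, rfl, rfl⟩)
    · exact bipartiteGraph_adj_inl.2 ⟨_, rfl, hτ i⟩
    · exact bipartiteGraph_adj_inr.2 ⟨_, rfl, hτ i⟩
  edge_vert _ := Set.mem_univ _
  symm := ⟨fun _ _ h => Or.symm h⟩

lemma matchingOfPerm_isPerfectMatching {x : Fin n × Fin n → Bool} {τ : Equiv.Perm (Fin n)}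
    (hτ : ∀ i, x (i, τ i) = true) : (matchingOfPerm x τ hτ).IsPerfectMatching := by
  refine SimpleGraph.Subgraph.isPerfectMatching_iff.2 fun v => ?_
  rcases v with i | j
  · refine ⟨Sum.inr (τ i), Or.inl ⟨i, rfl, rfl⟩, ?_⟩
    rintro w (⟨i', h, rfl⟩ | ⟨i', -, h⟩)
    · rw [Sum.inl.inj h]
    · simp at h
  · refine ⟨Sum.inl (τ.symm j), Or.inr ⟨τ.symm j, rfl, by simp⟩, ?_⟩
    rintro w (⟨i', h, -⟩ | ⟨i', rfl, h⟩)
    · simp at h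
    · rw [Sum.inr.inj h, Equiv.symm_apply_apply]

lemma exists_eq_matchingOfPerm {x : Fin n × Fin n → Bool} {M : (bipartiteGraph x).Subgraph}
    (hM : M.IsPerfectMatching) :
    ∃ (τ : Equiv.Perm (Fin n)) (hτ : ∀ i, x (i, τ i) = true), matchingOfPerm x τ hτ = M := by
  have huniq := SimpleGraph.Subgraph.isPerfectMatching_iff.1 hM
  have hex : ∀ i : Fin n, ∃ j : Fin n, M.Adj (Sum.inl i) (Sum.inr j) ∧ x (i, j) = true := by
    intro i
    obtain ⟨v, hv, -⟩ := huniq (Sum.inl i)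
    obtain ⟨j, rfl, hj⟩ := bipartiteGraph_adj_inl.1 hv.adj_sub
    exact ⟨j, hv, hj⟩
  choose g hg hgx using hex
  have hinj : Function.Injective g := fun i i' h => by
    have h1 := (hg i').symm
    rw [← h] at h1
    exact Sum.inl.inj ((huniq (Sum.inr (g i))).unique (hg i).symm h1)
  refine ⟨Equiv.ofBijective g (Finite.injective_iff_bijective.1 hinj), hgx, ?_⟩
  refine SimpleGraph.Subgraph.ext (SimpleGraph.Subgraph.isSpanning_iff.1 hM.2).symm ?_
  have hl : ∀ (i : Fin n) (v : Fin n ⊕ Fin n), M.Adj (Sum.inl i) v ↔ v = Sum.inr (g i) :=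
    fun i v => ⟨fun h => (huniq (Sum.inl i)).unique h (hg i), fun h => h ▸ hg i⟩
  funext u v
  refine propext ⟨?_, fun h => ?_⟩
  · rintro (⟨i, rfl, rfl⟩ | ⟨i, rfl, rfl⟩)
    · exact hg i
    · exact (hg i).symm
  · rcases u with i | j
    · exact Or.inl ⟨i, rfl, (hl i v).1 h⟩
    · obtain ⟨i, rfl, -⟩ := bipartiteGraph_adj_inr.1 h.adj_sub
      exact Or.inr ⟨i, rfl, (hl i _).1 h.symm⟩

/-- The perfect matchings of the bipartite graph are the permutations all of whose edges are
present. -/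
lemma perfectMatchings_bipartiteGraph (x : Fin n × Fin n → Bool) :
    (perfectMatchings (bipartiteGraph x) : ℝ)
      = ∑ τ : Equiv.Perm (Fin n), ∏ i, if x (i, τ i) = true then (1 : ℝ) else 0 := by
  have e : {τ : Equiv.Perm (Fin n) // ∀ i, x (i, τ i) = true} ≃
      {M : (bipartiteGraph x).Subgraph | M.IsPerfectMatching} :=
    Equiv.ofBijective
      (fun τ => ⟨matchingOfPerm x τ.1 τ.2, matchingOfPerm_isPerfectMatching τ.2⟩) (by
      constructor
      · intro τ τ' h
        have h' := congrArg SimpleGraph.Subgraph.Adj (congrArg Subtype.val h)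
        refine Subtype.ext (Equiv.ext fun i => ?_)
        have h1 : (matchingOfPerm x τ'.1 τ'.2).Adj (Sum.inl i) (Sum.inr (τ.1 i)) := by
          have := congrFun (congrFun h' (Sum.inl i)) (Sum.inr (τ.1 i))
          exact this.mp (Or.inl ⟨i, rfl, rfl⟩)
        rcases h1 with ⟨i', h2, h3⟩ | ⟨i', h2, -⟩
        · rw [Sum.inr.inj h3, Sum.inl.inj h2]
        · simp at h2
      · rintro ⟨M, hM⟩
        obtain ⟨τ, hτ, h⟩ := exists_eq_matchingOfPerm hM
        exact ⟨⟨τ, hτ⟩, Subtype.ext h⟩)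
  unfold perfectMatchings
  rw [← Nat.card_coe_set_eq, ← Nat.card_congr e, Nat.card_eq_fintype_card, Fintype.card_subtype,
    Finset.card_filter]
  push_cast
  refine Finset.sum_congr rfl fun τ _ => ?_
  rw [Finset.prod_ite_zero]
  simp

/-- On a finite vertex set every set of graphs is measurable, as graphs embed measurably into the
finite space of sets of edges. -/
lemma measurable_of_simpleGraph {V : Type*} [Finite V] (f : SimpleGraph V → ℝ) :
    Measurable f := by
  have h := SimpleGraph.measurableEmbedding_edgeSet (V := V)
  intro s _
  have : (f ⁻¹' s) = SimpleGraph.edgeSet ⁻¹' (SimpleGraph.edgeSet '' (f ⁻¹' s)) :=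
    (Set.preimage_image_eq _ SimpleGraph.edgeSet_injective).symm
  rw [this]
  exact h.measurable (Set.toFinite _).measurableSet

/-- The expected number of perfect matchings is the permanent of the matrix of edge
probabilities. -/
theorem expectedPerfectMatchings_eq_permanent {α β : ℕ} (F : Matrix (Fin α) (Fin β) I)
    (ω : Environment α β) (n : ℕ) :
    expectedPerfectMatchings F n ω = (edgeProbMatrix F n ω).permanent := by
  unfold expectedPerfectMatchings graphLaw
  rw [integral_map Measurable.of_discrete.aemeasurable
    (measurable_of_simpleGraph _).aestronglyMeasurable]
  simp only [perfectMatchings_bipartiteGraph]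
  have : IsProbabilityMeasure (edgeLaw F n ω) := by unfold edgeLaw; infer_instance
  rw [integral_finsetSum _ fun τ _ => Integrable.of_finite, ← Matrix.permanent_transpose]
  unfold Matrix.permanent
  refine Finset.sum_congr rfl fun τ _ => ?_
  -- Write the product over the edges of `τ` as a product over all pairs, to use independence.
  set g : Fin n × Fin n → Bool → ℝ := fun e b =>
    if e.2 = τ e.1 then (if b = true then 1 else 0) else 1 with hg
  have hprod : ∀ x : Fin n × Fin n → Bool,
      ∏ i, (if x (i, τ i) = true then (1 : ℝ) else 0) = ∏ e, g e (x e) := fun x => by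
    rw [Fintype.prod_prod_type]
    refine Finset.prod_congr rfl fun i _ => ?_
    simp [hg, Finset.prod_ite_eq']
  simp only [hprod]
  unfold edgeLaw
  rw [integral_fintype_prod_eq_prod, Fintype.prod_prod_type]
  refine Finset.prod_congr rfl fun i _ => ?_
  rw [Finset.prod_eq_single (τ i)]
  · simp [hg, integral_bernoulliMeasure, edgeProbMatrix]
  · intro j _ hj
    simp [hg, hj]
  · simp

end ExpectedMatchings

end RandomEnvironment

theorem theorem1 {α β : ℕ} (p : stdSimplex ℝ (Fin α)) (q : stdSimplex ℝ (Fin β))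
    (F : Matrix (Fin α) (Fin β) I) (hF : ∀ r s, 0 < F r s) :
    (∀ (ω : RandomEnvironment.Environment α β) (n : ℕ),
      RandomEnvironment.expectedPerfectMatchings F n ω
        = (RandomEnvironment.edgeProbMatrix F n ω).permanent) ∧
    ∀ᵐ ω ∂(RandomEnvironment.environmentMeasure p q),
      Tendsto
        (fun n : ℕ =>
          (RandomEnvironment.expectedPerfectMatchings F n ω / (n ! : ℝ)) ^ (1 / (n : ℝ)))
        atTop
        (𝓝 (RandomEnvironment.scalingMean (fun r => p r) (fun s => q s)
          (fun r s => (F r s : ℝ)))) := by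
  refine ⟨RandomEnvironment.expectedPerfectMatchings_eq_permanent F, ?_⟩
  have hfst : Measure.QuasiMeasurePreserving Prod.fst (RandomEnvironment.environmentMeasure p q)
      (RandomEnvironment.bernoulliShift p) := Measure.quasiMeasurePreserving_fst
  have hsnd : Measure.QuasiMeasurePreserving Prod.snd (RandomEnvironment.environmentMeasure p q)
      (RandomEnvironment.bernoulliShift q) := Measure.quasiMeasurePreserving_snd
  filter_upwards [hfst.ae (ae_all_iff.2 fun r => RandomEnvironment.ae_tendsto_prefixCount_div p r),
    hfst.ae (RandomEnvironment.ae_weight_ne_zero p),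
    hsnd.ae (ae_all_iff.2 fun s => RandomEnvironment.ae_tendsto_prefixCount_div q s),
    hsnd.ae (RandomEnvironment.ae_weight_ne_zero q)] with ω hw hw0 hm hm0
  simp only [RandomEnvironment.expectedPerfectMatchings_eq_permanent]
  exact RandomEnvironment.tendsto_permanent_rpow (f := fun r s => (F r s : ℝ)) p.2 q.2
    (fun r s => hF r s) hw0 hm0 hw hm
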